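/- All graphs are finite, simple and undirected. A $k$-star coloring of a graph $G$ is a proper vertex coloring of $G$ with colors from $\{1,\dots,k\}$ such that every path on four vertices receives at least three distinct colors; the star chromatic number $\chi_s(G)$ is the smallest $k$ for which $G$ has a $k$-star coloring. The tensor product $G\times H$ has vertex set $V(G)\times V(H)$, with $(u,v)$ adjacent to $(u',v')$ if and only if $uu'\in E(G)$ and $vv'\in E(H)$. Let $C_m$ and $P_n$ denote the cycle on $m$ vertices and the path on $n$ vertices. **Theorem.** For all integers $m\ge 3$ and $n\ge 2$: - if $n\in\{2,3\}$, then $\chi_s(C_m\times P_n)=3$; - if $3\mid m$ and $n\in\{4,5\}$, then $\chi_s(C_m\times P_n)=4$; - if $3\nmid m$ and $n\in\{4,5\}$, then $\chi_s(C_m\times P_n)\in\{4,5\}$; - in all other cases, that is, if $n\ge 6$, then $\chi_s(C_m\times P_n)=5$. -/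

import Mathlib

namespace SimpleGraph

/-- The tensor (direct, categorical) product of two simple graphs: `(u, v)` and `(u', v')` are
adjacent iff `u` is adjacent to `u'` in `G` and `v` is adjacent to `v'` in `H`. -/
def tensorProd {V W : Type*} (G : SimpleGraph V) (H : SimpleGraph W) : SimpleGraph (V × W) where
  Adj x y := G.Adj x.1 y.1 ∧ H.Adj x.2 y.2
  symm := ⟨fun _ _ h => ⟨h.1.symm, h.2.symm⟩⟩
  loopless := ⟨fun _ h => h.1.ne rfl⟩

/-- A proper colouring `C` is a star colouring if every path `a - b - c - d` on four (distinct)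
vertices receives at least three distinct colours. Consecutive vertices of the path are distinct
because they are adjacent. -/
def IsStarColoring {V α : Type*} [DecidableEq α] {G : SimpleGraph V} (C : G.Coloring α) : Prop :=
  ∀ a b c d : V, G.Adj a b → G.Adj b c → G.Adj c d → a ≠ c → a ≠ d → b ≠ d →
    3 ≤ ({C a, C b, C c, C d} : Finset α).card

/-- `G` has a star colouring with colours from a set of size `k`. -/
def StarColorable {V : Type*} (G : SimpleGraph V) (k : ℕ) : Prop :=
  ∃ C : G.Coloring (Fin k), IsStarColoring C

/-- The star chromatic number: the smallest `k` such that `G` has a `k`-star colouring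
(`⊤` if there is none, which never happens for a finite graph). -/
noncomputable def starChromaticNumber {V : Type*} (G : SimpleGraph V) : ℕ∞ :=
  ⨅ (k : ℕ) (_ : G.StarColorable k), (k : ℕ∞)

end SimpleGraph

namespace SimpleGraph

/-! A homomorphism injective on each neighbourhood sends a path on four vertices to a walk `a b c d`
with `a ≠ c`, `b ≠ d`, so star colourings pull back along it (`LocallyEmbeds.starColorable`). Each
bound thus reduces to a finite graph. Lower bounds: paths wrap into cycles, so the product contains
a local copy of a small `P_k × P_l`, on which exhaustive search rules out too few colours. Upper
bounds: paths wrap into `C_4` and cycles other than `C_5` map to the diamond, leaving two explicit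
5-colourings; if `3 ∣ m`, a 4-colouring of `C_3 × P_5` suffices. The 3-colouring for `n ≤ 3` is
built directly for every `m`. -/

/-- `f` is a star colouring of `G` with natural numbers as colours: it is proper, and no path on
four vertices is bicoloured. -/
def IsNatStarColoring {V : Type*} (G : SimpleGraph V) (f : V → ℕ) : Prop :=
  (∀ a b, G.Adj a b → f a ≠ f b) ∧
    ∀ a b, G.Adj a b → ∀ c, G.Adj b c → a ≠ c → f a = f c → ∀ d, G.Adj c d → b ≠ d → f b ≠ f d

theorem IsNatStarColoring.comp_injective {V : Type*} {G : SimpleGraph V} {f : V → ℕ}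
    (hf : G.IsNatStarColoring f) {g : ℕ → ℕ} (hg : g.Injective) :
    G.IsNatStarColoring (g ∘ f) :=
  ⟨fun a b h e => hf.1 a b h (hg e),
    fun a b hab c hbc hac e d hcd hbd e' => hf.2 a b hab c hbc hac (hg e) d hcd hbd (hg e')⟩

/-- Under a proper colouring, `a b c d` has only two colours exactly when both pairs at distance two
agree. The condition `a ≠ d` can be dropped: if `a = d`, properness already separates `b` from `d`.
-/
theorem starColorable_iff {V : Type*} {G : SimpleGraph V} {k : ℕ} :
    G.StarColorable k ↔ ∃ f : V → ℕ, (∀ v, f v < k) ∧ G.IsNatStarColoring f := by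
  constructor
  · rintro ⟨C, hC⟩
    refine ⟨fun v => C v, fun v => (C v).2, fun a b h e => C.valid h (Fin.ext e), ?_⟩
    intro a b hab c hbc hac e d hcd hbd e'
    replace e : C a = C c := Fin.ext e
    replace e' : C b = C d := Fin.ext e'
    by_cases had : a = d
    · subst had
      exact C.valid hab e'.symm
    · have h := hC a b c d hab hbc hcd hac had hbd
      have h2 : ({C a, C b, C c, C d} : Finset (Fin k)) ⊆ {C a, C b} := by
        intro x
        simp only [Finset.mem_insert, Finset.mem_singleton]
        rw [← e, ← e']
        tauto
      have := Finset.card_le_card h2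
      have := Finset.card_le_two (a := C a) (b := C b)
      omega
  · rintro ⟨f, hk, hf⟩
    refine ⟨Coloring.mk (fun v => ⟨f v, hk v⟩) fun {a b} h e => hf.1 a b h (Fin.ext_iff.1 e), ?_⟩
    intro a b c d hab hbc hcd hac had hbd
    have key : ∀ x y : V, (⟨f x, hk x⟩ : Fin k) = ⟨f y, hk y⟩ ↔ f x = f y :=
      fun x y => Fin.ext_iff
    change 3 ≤ ({⟨f a, hk a⟩, ⟨f b, hk b⟩, ⟨f c, hk c⟩, ⟨f d, hk d⟩} : Finset (Fin k)).card
    have h₁ := hf.1 a b hab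
    have h₂ := hf.1 b c hbc
    have h₃ := hf.1 c d hcd
    by_cases e : f a = f c
    · refine Nat.succ_le_of_lt (Finset.two_lt_card.2
        ⟨⟨f a, hk a⟩, by simp, ⟨f b, hk b⟩, by simp, ⟨f d, hk d⟩, by simp, ?_⟩)
      simp only [ne_eq, key]
      exact ⟨h₁, fun h => h₃ (e.symm.trans h), hf.2 a b hab c hbc hac e d hcd hbd⟩
    · refine Nat.succ_le_of_lt (Finset.two_lt_card.2
        ⟨⟨f a, hk a⟩, by simp, ⟨f b, hk b⟩, by simp, ⟨f c, hk c⟩, by simp, ?_⟩)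
      simp only [ne_eq, key]
      exact ⟨h₁, e, h₂⟩

theorem StarColorable.mono {V : Type*} {G : SimpleGraph V} {k l : ℕ} (h : G.StarColorable k)
    (hkl : k ≤ l) : G.StarColorable l := by
  rw [starColorable_iff] at h ⊢
  obtain ⟨f, hk, hf⟩ := h
  exact ⟨f, fun v => (hk v).trans_le hkl, hf⟩

theorem starChromaticNumber_eq_succ {V : Type*} {G : SimpleGraph V} {k : ℕ}
    (h : G.StarColorable (k + 1)) (h' : ¬ G.StarColorable k) :
    G.starChromaticNumber = (k + 1 : ℕ) := by
  refine le_antisymm (iInf₂_le (k + 1) h) (le_iInf₂ fun l hl => ?_)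
  rw [Nat.cast_le]
  by_contra hlk
  exact h' (hl.mono (by omega))

/-! ### Locally injective homomorphisms -/

/-- There is a homomorphism `G → H` that is injective on the neighbourhood of every vertex. -/
def LocallyEmbeds {V W : Type*} (G : SimpleGraph V) (H : SimpleGraph W) : Prop :=
  ∃ φ : G →g H, ∀ a b c, G.Adj a b → G.Adj b c → φ a = φ c → a = c

theorem LocallyEmbeds.starColorable {V W : Type*} {G : SimpleGraph V} {H : SimpleGraph W} {k : ℕ}
    (h : LocallyEmbeds G H) (hH : H.StarColorable k) : G.StarColorable k := by
  rw [starColorable_iff] at hH ⊢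
  obtain ⟨φ, hφ⟩ := h
  obtain ⟨f, hk, hf⟩ := hH
  refine ⟨f ∘ φ, fun v => hk _, fun a b h => hf.1 _ _ (φ.map_adj h), ?_⟩
  intro a b hab c hbc hac e d hcd hbd
  exact hf.2 _ _ (φ.map_adj hab) _ (φ.map_adj hbc) (fun e => hac (hφ _ _ _ hab hbc e)) e _
    (φ.map_adj hcd) (fun e => hbd (hφ _ _ _ hbc hcd e))

theorem LocallyEmbeds.tensorProd {V W V' W' : Type*} {G : SimpleGraph V} {H : SimpleGraph W}
    {G' : SimpleGraph V'} {H' : SimpleGraph W'} (h : LocallyEmbeds G G')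
    (h' : LocallyEmbeds H H') : LocallyEmbeds (G.tensorProd H) (G'.tensorProd H') := by
  obtain ⟨φ, hφ⟩ := h
  obtain ⟨ψ, hψ⟩ := h'
  refine ⟨⟨fun x => (φ x.1, ψ x.2), fun h => ⟨φ.map_adj h.1, ψ.map_adj h.2⟩⟩, ?_⟩
  intro a b c hab hbc e
  obtain ⟨e₁, e₂⟩ := Prod.ext_iff.1 e
  exact Prod.ext (hφ _ _ _ hab.1 hbc.1 e₁) (hψ _ _ _ hab.2 hbc.2 e₂)

theorem LocallyEmbeds.refl {V : Type*} (G : SimpleGraph V) : LocallyEmbeds G G :=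
  ⟨Hom.id, fun _ _ _ _ _ e => e⟩

theorem cycleGraph_adj_iff_val {m : ℕ} (hm : 2 ≤ m) {u v : Fin m} :
    (cycleGraph m).Adj u v ↔ u.val + 1 = v ∨ v.val + 1 = u ∨
      (u.val = 0 ∧ v.val + 1 = m) ∨ (v.val = 0 ∧ u.val + 1 = m) := by
  rw [cycleGraph_adj']
  have hu := u.2
  have hv := v.2
  rcases lt_trichotomy u v with h | h | h
  · rw [Fin.coe_sub_iff_lt.2 h, Fin.coe_sub_iff_le.2 h.le]
    rw [Fin.lt_def] at h
    omega
  · subst h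
    rw [Fin.coe_sub_iff_le.2 le_rfl]
    omega
  · rw [Fin.coe_sub_iff_lt.2 h, Fin.coe_sub_iff_le.2 h.le]
    rw [Fin.lt_def] at h
    omega

theorem pathGraph_locallyEmbeds_pathGraph {k n : ℕ} (h : k ≤ n) :
    LocallyEmbeds (pathGraph k) (pathGraph n) := by
  refine ⟨⟨Fin.castLE h, fun {a b} hab => ?_⟩, fun a b c _ _ e => Fin.castLE_injective h e⟩
  simpa [pathGraph_adj] using hab

theorem succ_mod_cases {p : ℕ} (hp : 0 < p) (i : ℕ) :
    (i + 1) % p = i % p + 1 ∨ (i % p + 1 = p ∧ (i + 1) % p = 0) := by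
  have h := Nat.mod_lt i hp
  rw [Nat.add_mod_eq_add_mod_right 1 (Nat.mod_mod i p).symm]
  rcases Nat.lt_or_ge (i % p + 1) p with h' | h'
  · exact .inl (Nat.mod_eq_of_lt h')
  · have e : i % p + 1 = p := by omega
    exact .inr ⟨e, by rw [e, Nat.mod_self]⟩

theorem pathGraph_locallyEmbeds_cycleGraph (n : ℕ) {p : ℕ} (hp : 3 ≤ p) :
    LocallyEmbeds (pathGraph n) (cycleGraph p) := by
  have hp0 : 0 < p := by omega
  refine ⟨⟨fun i => ⟨i % p, Nat.mod_lt _ hp0⟩, fun {a b} hab => ?_⟩, fun a b c hab hbc e => ?_⟩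
  · rw [cycleGraph_adj_iff_val (by omega)]
    rw [pathGraph_adj] at hab
    rcases hab with h | h
    · rw [← h]
      have := succ_mod_cases hp0 a
      dsimp only
      omega
    · rw [← h]
      have := succ_mod_cases hp0 b
      dsimp only
      omega
  · rw [pathGraph_adj] at hab hbc
    replace e : a.val % p = c.val % p := Fin.ext_iff.1 e
    have h₁ := succ_mod_cases hp0 a
    have h₂ := succ_mod_cases hp0 b
    have h₃ := succ_mod_cases hp0 c
    apply Fin.ext
    rcases hab with h | h <;> rcases hbc with h' | h'
    · rw [h] at h₁
      rw [h'] at h₂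
      omega
    · omega
    · omega
    · rw [h] at h₂
      rw [h'] at h₃
      omega

theorem cycleGraph_locallyEmbeds_cycleGraph_three {m : ℕ} (hm : 3 ≤ m) (h3 : 3 ∣ m) :
    LocallyEmbeds (cycleGraph m) (cycleGraph 3) := by
  refine ⟨⟨fun i => ⟨i % 3, by omega⟩, fun {a b} hab => ?_⟩, fun a b c hab hbc e => ?_⟩
  · rw [cycleGraph_adj_iff_val (by omega)] at hab ⊢
    dsimp only
    omega
  · rw [cycleGraph_adj_iff_val (by omega)] at hab hbc
    replace e : a.val % 3 = c.val % 3 := Fin.ext_iff.1 e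
    apply Fin.ext
    omega

/-- The diamond: the complete graph on `{0, 1, 2, 3}` without the edge `{1, 3}`. -/
def diamond : SimpleGraph (Fin 4) where
  Adj i j := i ≠ j ∧ i.val + j.val ≠ 4
  symm := ⟨fun _ _ h => ⟨h.1.symm, by rw [add_comm]; exact h.2⟩⟩
  loopless := ⟨fun _ h => h.1 rfl⟩

instance : DecidableRel diamond.Adj := fun i j =>
  inferInstanceAs (Decidable (i ≠ j ∧ i.val + j.val ≠ 4))

theorem diamond_adj_iff_val {i j : Fin 4} :
    diamond.Adj i j ↔ i.val ≠ j ∧ i.val + j.val ≠ 4 := by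
  rw [ne_eq (i : ℕ), ← Fin.ext_iff]
  rfl

theorem cycleGraph_locallyEmbeds_diamond {m : ℕ} (hm : 3 ≤ m) (s : ℕ → ℕ) (hs : ∀ i, s i < 4)
    (hadj : ∀ i j, i < m → j < m → (i + 1 = j ∨ (j = 0 ∧ i + 1 = m)) →
      s i ≠ s j ∧ s i + s j ≠ 4)
    (hinj : ∀ i j k, i < m → j < m → k < m → (i + 1 = j ∨ (j = 0 ∧ i + 1 = m)) →
      (j + 1 = k ∨ (k = 0 ∧ j + 1 = m)) → s i ≠ s k) :
    LocallyEmbeds (cycleGraph m) diamond := by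
  refine ⟨⟨fun i => ⟨s i, hs i⟩, fun {a b} hab => ?_⟩, fun a b c hab hbc e => ?_⟩
  · rw [cycleGraph_adj_iff_val (by omega)] at hab
    rw [diamond_adj_iff_val]
    have h₁ := hadj a b a.2 b.2
    have h₂ := hadj b a b.2 a.2
    dsimp only
    omega
  · rw [cycleGraph_adj_iff_val (by omega)] at hab hbc
    replace e : s a = s c := Fin.ext_iff.1 e
    have h₁ := hinj a b c a.2 b.2 c.2
    have h₂ := hinj c b a c.2 b.2 a.2
    apply Fin.ext
    omega

/-- Closed walks `012` and `0123` in the diamond can be concatenated freely without backtracking, so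
every `m = 3a + 4b` works. The residue of `m` mod 3 is the number of blocks `0123` used; two of them
need `m ≥ 8`, which excludes only 5. -/
theorem cycleGraph_locallyEmbeds_diamond_of_ne_five {m : ℕ} (hm : 3 ≤ m) (h5 : m ≠ 5) :
    LocallyEmbeds (cycleGraph m) diamond := by
  have h : m % 3 = 0 ∨ m % 3 = 1 ∨ m % 3 = 2 := by omega
  rcases h with h | h | h
  · refine cycleGraph_locallyEmbeds_diamond hm (fun i => i % 3) ?_ ?_ ?_ <;> intros <;> omega
  · refine cycleGraph_locallyEmbeds_diamond hm (fun i => if i + 1 = m then 3 else i % 3) ?_ ?_ ?_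
      <;> intros <;> split_ifs <;> omega
  · refine cycleGraph_locallyEmbeds_diamond hm
      (fun i => if i + 1 = m ∨ i = 3 then 3 else if i < 3 then i else (i + 2) % 3) ?_ ?_ ?_
      <;> intros <;> split_ifs <;> omega

/-! ### Exhaustive search with colour symmetry breaking -/

section Search

variable {V : Type*} [DecidableEq V]

/-- Giving colour `c` to `v` creates neither a monochromatic edge nor a bicoloured path on four
vertices with the partial colouring `l`. -/
def compatible (adj : V → V → Bool) (l : List (V × ℕ)) (v : V) (c : ℕ) : Bool :=
  let nbrs := l.filter fun p => adj v p.1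
  (nbrs.all fun p => !(p.2 == c)) &&
  (nbrs.all fun p => (l.filter fun q => q.2 == c && adj p.1 q.1).all fun q =>
    decide (q.1 = v) || l.all fun r => !(r.2 == p.2 && adj q.1 r.1) || decide (r.1 = p.1)) &&
  (nbrs.all fun p => (nbrs.filter fun q => q.2 == p.2).all fun q =>
    decide (q.1 = p.1) || l.all fun r => !(r.2 == c && adj q.1 r.1) || decide (r.1 = v))

/-- Exhaustive search for an extension of the partial colouring `l`, with colours below `m`, to the
vertices in the list, with at most `k` colours and up to renaming the unused colours. -/
def existsExtension (adj : V → V → Bool) (k : ℕ) : List V → ℕ → List (V × ℕ) → Bool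
  | [], _, _ => true
  | v :: vs, m, l => (List.range (min k (m + 1))).any fun c =>
      compatible adj l v c && existsExtension adj k vs (max m (c + 1)) ((v, c) :: l)

/-- Up to reversal, a bicoloured path through `v` is `v p q r` or `p v q r`; the last two tests of
`compatible` treat these cases. -/
theorem IsNatStarColoring.compatible {G : SimpleGraph V} {f : V → ℕ} (hf : G.IsNatStarColoring f)
    {adj : V → V → Bool} (hadj : ∀ u v, adj u v = true → G.Adj u v) {l : List (V × ℕ)}
    (hl : ∀ p ∈ l, f p.1 = p.2) (v : V) : SimpleGraph.compatible adj l v (f v) = true := by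
  simp only [SimpleGraph.compatible, Bool.and_eq_true, List.all_eq_true, List.mem_filter,
    Bool.or_eq_true, Bool.not_eq_true', decide_eq_true_eq, Bool.and_eq_false_iff, and_imp,
    beq_iff_eq, beq_eq_false_iff_ne, ne_eq]
  refine ⟨⟨?_, ?_⟩, ?_⟩
  · intro p hp h e
    rw [← hl p hp] at e
    exact hf.1 _ _ (hadj _ _ h) e.symm
  · intro p hp h q hq e h'
    by_contra! hc
    obtain ⟨hqv, r, hr, ⟨hc, hqr⟩, hne⟩ := hc
    refine hf.2 v p.1 (hadj _ _ h) q.1 (hadj _ _ h') (Ne.symm hqv) ?_ r.1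
      (hadj _ _ (by simpa using hqr)) (Ne.symm hne) ?_
    · rw [hl q hq, e]
    · rw [hl p hp, hl r hr, hc]
  · intro p hp h q hq h' e
    by_contra! hc
    obtain ⟨hqp, r, hr, ⟨hc, hqr⟩, hne⟩ := hc
    refine hf.2 p.1 v (hadj _ _ h).symm q.1 (hadj _ _ h') (Ne.symm hqp) ?_ r.1
      (hadj _ _ (by simpa using hqr)) (Ne.symm hne) ?_
    · rw [hl p hp, hl q hq, e]
    · rw [hl r hr, hc]

theorem IsNatStarColoring.existsExtension {G : SimpleGraph V} {f : V → ℕ}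
    (hf : G.IsNatStarColoring f) {k : ℕ} (hk : ∀ v, f v < k)
    {adj : V → V → Bool} (hadj : ∀ u v, adj u v = true → G.Adj u v) (vs : List V) {m : ℕ}
    {l : List (V × ℕ)} (hl : ∀ p ∈ l, f p.1 = p.2) (hm : ∀ p ∈ l, p.2 < m) :
    SimpleGraph.existsExtension adj k vs m l = true := by
  induction vs generalizing f m l with
  | nil => rfl
  | cons v vs ih =>
    have key : ∀ g : V → ℕ, G.IsNatStarColoring g → (∀ v, g v < k) → (∀ p ∈ l, g p.1 = p.2) →
        g v ≤ m → SimpleGraph.existsExtension adj k (v :: vs) m l = true := by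
      intro g hg hgk hgl hgm
      rw [SimpleGraph.existsExtension, List.any_eq_true]
      refine ⟨g v, List.mem_range.2 (lt_min (hgk v) (by omega)), ?_⟩
      rw [Bool.and_eq_true]
      refine ⟨hg.compatible hadj hgl v, ih hg hgk ?_ ?_⟩
      · simpa using hgl
      · intro p hp
        rcases List.mem_cons.1 hp with rfl | hp
        · simp
        · exact lt_max_of_lt_left (hm p hp)
    rcases le_or_gt (f v) m with h | h
    · exact key f hf hk hl h
    -- Here `m < f v` and `l` only uses colours below `m`, so the swap fixes `l` and gives `v` the
    -- first fresh colour.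
    · refine key (Equiv.swap m (f v) ∘ f) (hf.comp_injective (Equiv.injective _)) ?_ ?_ ?_
      · intro w
        have := hk w
        have := hk v
        rw [Function.comp_apply, Equiv.swap_apply_def]
        split_ifs <;> omega
      · intro p hp
        have := hm p hp
        rw [Function.comp_apply, hl p hp, Equiv.swap_apply_of_ne_of_ne (by omega) (by omega)]
      · simp

theorem not_starColorable_of_existsExtension_eq_false {G : SimpleGraph V} {k : ℕ}
    {adj : V → V → Bool} (hadj : ∀ u v, adj u v = true → G.Adj u v) (vs : List V)
    (h : existsExtension adj k vs 0 [] = false) : ¬ G.StarColorable k := by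
  rw [starColorable_iff]
  rintro ⟨f, hk, hf⟩
  have := hf.existsExtension hk hadj vs (m := 0) (l := []) (by simp) (by simp)
  simp [h] at this

end Search

/-! ### Lower bounds from small grids -/

/-- Adjacency in the tensor product of two paths. -/
def gridAdj {k n : ℕ} (u v : Fin k × Fin n) : Bool :=
  (Nat.beq (u.1.val + 1) v.1.val || Nat.beq (v.1.val + 1) u.1.val) &&
    (Nat.beq (u.2.val + 1) v.2.val || Nat.beq (v.2.val + 1) u.2.val)

theorem adj_of_gridAdj {k n : ℕ} (u v : Fin k × Fin n) (h : gridAdj u v = true) :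
    ((pathGraph k).tensorProd (pathGraph n)).Adj u v := by
  simp only [gridAdj, Bool.and_eq_true, Bool.or_eq_true, Nat.beq_eq] at h
  exact ⟨pathGraph_adj.2 h.1, pathGraph_adj.2 h.2⟩

theorem not_starColorable_pathGraph_eight_six :
    ¬ ((pathGraph 8).tensorProd (pathGraph 6)).StarColorable 4 :=
  not_starColorable_of_existsExtension_eq_false adj_of_gridAdj
    [(3, 3), (4, 2), (2, 2), (3, 1), (4, 4), (5, 3), (1, 3), (2, 4), (3, 5), (4, 0), (5, 1),
      (6, 2), (0, 2), (1, 1), (2, 0), (6, 4), (7, 3), (7, 1)] (by decide +kernel)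

theorem not_starColorable_pathGraph_four_four :
    ¬ ((pathGraph 4).tensorProd (pathGraph 4)).StarColorable 3 :=
  not_starColorable_of_existsExtension_eq_false adj_of_gridAdj
    [(0, 0), (0, 2), (1, 1), (1, 3), (2, 0), (2, 2), (3, 1), (3, 3)] (by decide +kernel)

theorem not_starColorable_pathGraph_four_two :
    ¬ ((pathGraph 4).tensorProd (pathGraph 2)).StarColorable 2 :=
  not_starColorable_of_existsExtension_eq_false adj_of_gridAdj
    [(0, 0), (1, 1), (2, 0), (3, 1)] (by decide +kernel)

theorem not_starColorable_of_pathGraph {m n k l c : ℕ} (hm : 3 ≤ m) (hn : l ≤ n)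
    (h : ¬ ((pathGraph k).tensorProd (pathGraph l)).StarColorable c) :
    ¬ ((cycleGraph m).tensorProd (pathGraph n)).StarColorable c := fun h' =>
  h (((pathGraph_locallyEmbeds_cycleGraph k hm).tensorProd
    (pathGraph_locallyEmbeds_pathGraph hn)).starColorable h')

instance {n : ℕ} : DecidableRel (pathGraph n).Adj := fun _ _ => decidable_of_iff' _ pathGraph_adj

instance {V W : Type*} (G : SimpleGraph V) (H : SimpleGraph W) [DecidableRel G.Adj]
    [DecidableRel H.Adj] : DecidableRel (G.tensorProd H).Adj := fun x y =>
  inferInstanceAs (Decidable (G.Adj x.1 y.1 ∧ H.Adj x.2 y.2))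

instance {V : Type*} [Fintype V] [DecidableEq V] (G : SimpleGraph V) [DecidableRel G.Adj]
    (f : V → ℕ) : Decidable (G.IsNatStarColoring f) :=
  inferInstanceAs (Decidable (_ ∧ _))

/-! ### Upper bounds from explicit colourings -/

theorem starColorable_diamond_cycleGraph_four :
    (diamond.tensorProd (cycleGraph 4)).StarColorable 5 := by
  rw [starColorable_iff]
  refine ⟨fun x => (![![4, 4, 3, 3], ![0, 0, 0, 0], ![2, 2, 1, 1], ![0, 0, 0, 0]] :
    Fin 4 → Fin 4 → ℕ) x.1 x.2, ?_⟩
  decide +kernel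

theorem starColorable_cycleGraph_five_four :
    ((cycleGraph 5).tensorProd (cycleGraph 4)).StarColorable 5 := by
  rw [starColorable_iff]
  refine ⟨fun x => (![![3, 2, 0, 1], ![3, 4, 0, 4], ![1, 4, 2, 4], ![1, 0, 2, 3],
    ![4, 4, 4, 4]] : Fin 5 → Fin 4 → ℕ) x.1 x.2, ?_⟩
  decide +kernel

theorem starColorable_cycleGraph_three_pathGraph_five :
    ((cycleGraph 3).tensorProd (pathGraph 5)).StarColorable 4 := by
  rw [starColorable_iff]
  refine ⟨fun x => (![![3, 1, 1, 1, 3], ![3, 0, 0, 0, 3], ![3, 2, 2, 2, 3]] :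
    Fin 3 → Fin 5 → ℕ) x.1 x.2, ?_⟩
  decide +kernel

theorem starColorable_five {m : ℕ} (hm : 3 ≤ m) (n : ℕ) :
    ((cycleGraph m).tensorProd (pathGraph n)).StarColorable 5 := by
  have hn := pathGraph_locallyEmbeds_cycleGraph n (p := 4) (by omega)
  by_cases h5 : m = 5
  · subst h5
    exact ((LocallyEmbeds.refl _).tensorProd hn).starColorable starColorable_cycleGraph_five_four
  · exact ((cycleGraph_locallyEmbeds_diamond_of_ne_five hm h5).tensorProd hn).starColorable
      starColorable_diamond_cycleGraph_four

theorem starColorable_four {m n : ℕ} (hm : 3 ≤ m) (h3 : 3 ∣ m) (hn : n ≤ 5) :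
    ((cycleGraph m).tensorProd (pathGraph n)).StarColorable 4 :=
  ((cycleGraph_locallyEmbeds_cycleGraph_three hm h3).tensorProd
    (pathGraph_locallyEmbeds_pathGraph hn)).starColorable
    starColorable_cycleGraph_three_pathGraph_five

/-- The pattern `0 0 1 1 0 0 1 1 …` separates indices two apart, and colour 2 on the last two
indices repairs the wrap-around. For `m = 3` those two indices share a neighbour, so this case is
separate. -/
theorem exists_three_coloring_cycle_two_apart {m : ℕ} (hm : 3 ≤ m) :
    ∃ g : ℕ → ℕ, (∀ i, g i < 3) ∧
      ∀ i < m, g (if i = 0 then m - 1 else i - 1) ≠ g (if i + 1 = m then 0 else i + 1) := by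
  rcases hm.eq_or_lt with rfl | hm
  · exact ⟨fun i => i % 3, fun i => Nat.mod_lt _ (by omega), by decide⟩
  · refine ⟨fun i => if m - 2 ≤ i then 2 else i / 2 % 2, fun i => ?_, fun i hi => ?_⟩
    · dsimp only
      split_ifs <;> omega
    · dsimp only
      split_ifs <;> omega

/-- Every edge joins the layer with second coordinate 1 to its complement, so a path on four
vertices has two vertices at distance two in that layer. There `g` separates them, and an outer
vertex takes the colour missing from its neighbours. -/
theorem starColorable_three {m n : ℕ} (hm : 3 ≤ m) (hn : n ≤ 3) :
    ((cycleGraph m).tensorProd (pathGraph n)).StarColorable 3 := by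
  obtain ⟨g, hg3, hg⟩ := exists_three_coloring_cycle_two_apart hm
  set p : ℕ → ℕ := fun i => if i = 0 then m - 1 else i - 1
  set s : ℕ → ℕ := fun i => if i + 1 = m then 0 else i + 1
  replace hg : ∀ i < m, g (p i) ≠ g (s i) := hg
  have hps : ∀ u v : Fin m, (cycleGraph m).Adj u v → u.val = p v ∨ u.val = s v := by
    intro u v h
    rw [cycleGraph_adj_iff_val (by omega)] at h
    simp only [p, s]
    split_ifs <;> omega
  have hmid : ∀ a b c : Fin m, (cycleGraph m).Adj a b → (cycleGraph m).Adj b c → a ≠ c →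
      g a ≠ g c := by
    intro a b c hab hbc hac
    have := hg b b.2
    rw [ne_eq, Fin.ext_iff] at hac
    rcases hps a b hab with h | h <;> rcases hps c b hbc.symm with h' | h' <;>
      first | exact absurd (h.trans h'.symm) hac | (rw [h, h']; first | exact this | exact this.symm)
  -- The colours 0, 1, 2 sum to 3, so `3 - x - y` is the third colour when `x ≠ y`.
  have hout : ∀ u v : Fin m, (cycleGraph m).Adj u v → g u ≠ 3 - g (p v) - g (s v) := by
    intro u v h
    have h₁ := hg v v.2
    have h₂ := hg3 (p v)
    have h₃ := hg3 (s v)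
    rcases hps u v h with h | h <;> rw [h] <;> omega
  have hrow : ∀ i j : Fin n, (pathGraph n).Adj i j →
      (i.val = 1 ∧ j.val ≠ 1) ∨ (i.val ≠ 1 ∧ j.val = 1) := by
    intro i j h
    rw [pathGraph_adj] at h
    omega
  have hmid' : ∀ a b c : Fin m × Fin n, ((cycleGraph m).tensorProd (pathGraph n)).Adj a b →
      ((cycleGraph m).tensorProd (pathGraph n)).Adj b c → a ≠ c → a.2.val = 1 → c.2.val = 1 →
      g a.1 ≠ g c.1 := fun a b c hab hbc hac ha hc =>
    hmid _ _ _ hab.1 hbc.1 fun h => hac (Prod.ext h (Fin.ext (ha.trans hc.symm)))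
  rw [starColorable_iff]
  refine ⟨fun x => if x.2.val = 1 then g x.1 else 3 - g (p x.1) - g (s x.1), fun x => ?_, ?_, ?_⟩
  · have h₁ := hg x.1 x.1.2
    have h₂ := hg3 x.1
    dsimp only
    split_ifs <;> omega
  · intro a b hab
    rcases hrow _ _ hab.2 with ⟨ha, hb⟩ | ⟨ha, hb⟩
    · simpa only [if_pos ha, if_neg hb] using hout _ _ hab.1
    · simpa only [if_pos hb, if_neg ha] using (hout _ _ hab.1.symm).symm
  · intro a b hab c hbc hac e d hcd hbd
    rcases hrow _ _ hab.2 with ⟨ha, hb⟩ | ⟨ha, hb⟩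
    · have hc : c.2.val = 1 := by
        have := hrow _ _ hbc.2
        omega
      simp only [if_pos ha, if_pos hc] at e
      exact absurd e (hmid' a b c hab hbc hac ha hc)
    · have hd : d.2.val = 1 := by
        have := hrow _ _ hbc.2
        have := hrow _ _ hcd.2
        omega
      simpa only [if_pos hb, if_pos hd] using hmid' b c d hbc hcd hbd hb hd

end SimpleGraph

open SimpleGraph in
theorem mainTheorem4 (m n : ℕ) (hm : 3 ≤ m) (hn : 2 ≤ n) :
    ((n = 2 ∨ n = 3) →
      ((SimpleGraph.cycleGraph m).tensorProd (SimpleGraph.pathGraph n)).starChromaticNumber = 3) ∧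
    (3 ∣ m → (n = 4 ∨ n = 5) →
      ((SimpleGraph.cycleGraph m).tensorProd (SimpleGraph.pathGraph n)).starChromaticNumber = 4) ∧
    (¬ 3 ∣ m → (n = 4 ∨ n = 5) →
      ((SimpleGraph.cycleGraph m).tensorProd (SimpleGraph.pathGraph n)).starChromaticNumber = 4 ∨
      ((SimpleGraph.cycleGraph m).tensorProd (SimpleGraph.pathGraph n)).starChromaticNumber = 5) ∧
    (¬ (n = 2 ∨ n = 3 ∨ n = 4 ∨ n = 5) →
      ((SimpleGraph.cycleGraph m).tensorProd (SimpleGraph.pathGraph n)).starChromaticNumber = 5) := by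
  refine ⟨fun h => ?_, fun h3 h => ?_, fun _ h => ?_, fun h => ?_⟩
  · exact starChromaticNumber_eq_succ (starColorable_three hm (by omega))
      (not_starColorable_of_pathGraph hm hn not_starColorable_pathGraph_four_two)
  · exact starChromaticNumber_eq_succ (starColorable_four hm h3 (by omega))
      (not_starColorable_of_pathGraph hm (by omega) not_starColorable_pathGraph_four_four)
  · by_cases h4 : ((cycleGraph m).tensorProd (pathGraph n)).StarColorable 4
    · exact .inl (starChromaticNumber_eq_succ h4
        (not_starColorable_of_pathGraph hm (by omega) not_starColorable_pathGraph_four_four))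
    · exact .inr (starChromaticNumber_eq_succ (starColorable_five hm n) h4)
  · exact starChromaticNumber_eq_succ (starColorable_five hm n)
      (not_starColorable_of_pathGraph hm (by omega) not_starColorable_pathGraph_eight_six)
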